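/- For $N\ge 1$ let $p^{(N)}(0,u)$ denote the density at $u\in\mathbb R$ of the mean of $N$ independent random variables that are uniformly distributed on $[-1,1]$, that is, $$p^{(N)}(0,u)=\int \delta\Big(u-\frac1N\sum_{i=1}^N u_i\Big)\prod_{i=1}^N P(u_i)\,du_i = N\int_{\mathbb R^{N-1}}\prod_{i=1}^{N-1}P(u_i)\;P\Big(Nu-\sum_{i=1}^{N-1}u_i\Big)\,du_1\cdots du_{N-1},\qquad P=\tfrac12\mathbf 1_{[-1,1]}.$$ For $N\ge 2$ this is the continuous version of the density of the mean, and for every $u\in\mathbb R$ $$p^{(N)}(0,u)=\frac1{2\pi}\int_{-\infty}^{\infty}\left(\frac{\sin(\omega/N)}{\omega/N}\right)^{N}e^{-i\omega u}\,d\omega ,$$ where the integral converges absolutely (and the quotient is read as $1$ at $\omega=0$). **Theorem 4.1.** For every fixed real $y\neq 0$ put $u=\frac1y-\coth y$. Then, as $N\to\infty$, $$p^{(N)}(0,u)=y\,\sinh y\,\sqrt{\frac{N}{2\pi(\sinh^2y-y^2)}}\left(\frac{\sinh y}{y}\,e^{uy}\right)^{N}\left(1+O\Big(\frac1N\Big)\right).$$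 For $y=0$, where $u$ and the right-hand side are understood as their limits for $y\to0$ (so $u=0$), the formula reads $$p^{(N)}(0,0)=\sqrt{\frac{3N}{2\pi}}\left(1+O\Big(\frac1N\Big)\right),\qquad N\to\infty .$$ The implied constants may depend on $y$ but not on $N$. -/

import Mathlib

open MeasureTheory ProbabilityTheory Filter Asymptotics

/-- The density `1/2` on `[-1, 1]`, zero elsewhere, of the uniform distribution on `[-1, 1]`. -/
noncomputable def uniformDensity : ℝ → ℝ :=
  Set.indicator (Set.Icc (-1) 1) (fun _ => 1 / 2)

/-- The density at `u` of the mean of `N ≥ 1` independent uniform variables on `[-1, 1]`, i.e.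
`∫ δ(u - (u₁ + ⋯ + u_N) / N) ∏ P(uᵢ) du₁ ⋯ du_N` with `P = uniformDensity`. The delta function is
integrated out in the last variable: it forces `u_N = N u - (u₁ + ⋯ + u_{N-1})` and contributes
the factor `N`. -/
noncomputable def meanDensity (N : ℕ) (u : ℝ) : ℝ :=
  N * ∫ x : Fin (N - 1) → ℝ,
    (∏ i, uniformDensity (x i)) * uniformDensity (N * u - ∑ i, x i)

/-- The law of the mean of `N` independent random variables, uniform on `[-1, 1]`. -/
noncomputable def uniformMeanLaw (N : ℕ) : Measure ℝ :=
  (Measure.pi fun _ : Fin N => cond (volume : Measure ℝ) (Set.Icc (-1) 1)).map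
    (fun x => (∑ i, x i) / N)

/-! For every real `t`, multiplying the density of the sum of `N ≥ 2` variables by `exp (t * s)`
gives a continuous integrable function whose Fourier transform is `M(t + iw) ^ N`, where `M(z) =
sinh z / z`. Inverting it writes the density of the mean as `N / (2π)` times the integral over `w`
of `(M(t + iw) exp (-(t + iw) u)) ^ N`. Since inversion is applied to each tilted function
separately, no contour has to be shifted (`exp_mul_sumDensity_eq_integral`,
`meanDensity_eq_integral`). Taking `t = 0` gives the sinc formula.

For the asymptotics, `t = -y` is the saddle point: the tilted uniform law then has mean `u`. Divided
by its value `Z` at `w = 0`, the base of the power is a centred characteristic function `φ(w) = 1 -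
a w² + i k w³ + O(w⁴)`, with `|φ| < 1` off `0` and `|φ|² = O(1 / (1 + w²))`. Near `0`, `φ ^ N` is
compared with `exp (-N a w² + i N k w³)`; elsewhere it is exponentially small
(`exists_pointwise_bound`). The cubic term is kept because discarding it pointwise would only give a
relative error `N ^ (-1/2)`; in the real part it acts only through a cosine, hence quadratically.
The scaling `w = v / √N` then gives relative error `O(1 / N)` (`exists_abs_integral_pow_sub_le`). -/

/-! ### Convolution powers and their integrals -/

/-- The density at `s` of the sum of `n + 1` independent variables with density `g`. -/
noncomputable def sumDensity {𝕜 : Type*} [RCLike 𝕜] (g : ℝ → 𝕜) (n : ℕ) (s : ℝ) : 𝕜 :=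
  ∫ x : Fin n → ℝ, (∏ i, g (x i)) * g (s - ∑ i, x i)

/-- This shear carries a product function to the convolution integrand, so integrability of the
latter needs no induction on `n`. -/
lemma measurePreserving_sub_sum (n : ℕ) :
    MeasurePreserving (fun p : (Fin n → ℝ) × ℝ => (p.1, p.2 - ∑ i, p.1 i))
      (volume.prod volume) (volume.prod volume) := by
  refine MeasurePreserving.skew_product (g := fun (x : Fin n → ℝ) s => s - ∑ i, x i)
    (MeasurePreserving.id volume) ?_ ?_
  · simp only [Function.uncurry_def]
    fun_prop
  · exact .of_forall fun x => (measurePreserving_sub_right volume _).map_eq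

lemma integrable_prod_mul_sub_sum {𝕜 : Type*} [RCLike 𝕜] {g : ℝ → 𝕜} (hg : Integrable g)
    (n : ℕ) :
    Integrable (fun p : (Fin n → ℝ) × ℝ => (∏ i, g (p.1 i)) * g (p.2 - ∑ i, p.1 i))
      (volume.prod volume) := by
  have h : Integrable (fun p : (Fin n → ℝ) × ℝ => (∏ i, g (p.1 i)) * g p.2)
      (volume.prod volume) :=
    (Integrable.fintype_prod (f := fun _ : Fin n => g) fun _ => hg).mul_prod hg
  exact (measurePreserving_sub_sum n).integrable_comp_of_integrable h

lemma integrable_sumDensity {𝕜 : Type*} [RCLike 𝕜] {g : ℝ → 𝕜} (hg : Integrable g) (n : ℕ) :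
    Integrable (sumDensity g n) :=
  (integrable_prod_mul_sub_sum hg n).integral_prod_right

lemma integral_sumDensity {𝕜 : Type*} [RCLike 𝕜] {g : ℝ → 𝕜} (hg : Integrable g) (n : ℕ) :
    ∫ s, sumDensity g n s = (∫ x, g x) ^ (n + 1) := by
  have h := integrable_prod_mul_sub_sum hg n
  simp only [sumDensity]
  rw [integral_integral_swap (f := fun s (x : Fin n → ℝ) => (∏ i, g (x i)) * g (s - ∑ i, x i)) h.swap]
  simp_rw [integral_const_mul, integral_sub_right_eq_self g]
  rw [integral_mul_const, integral_fintype_prod_volume_eq_pow g, Fintype.card_fin, pow_succ]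

/-! ### The moment generating function of the uniform law -/

/-- The moment generating function of the uniform law on `[-1, 1]`, at a complex argument. -/
noncomputable def uniformMGF (z : ℂ) : ℂ :=
  ∫ x : ℝ, (uniformDensity x : ℂ) * Complex.exp (z * x)

lemma uniformDensity_mul_eq_indicator (h : ℝ → ℂ) :
    (fun x => (uniformDensity x : ℂ) * h x) =
      Set.indicator (Set.Icc (-1) 1) (fun x => 1 / 2 * h x) := by
  ext x
  by_cases hx : x ∈ Set.Icc (-1 : ℝ) 1 <;> simp [uniformDensity, hx]

lemma integrable_uniformDensity_mul {h : ℝ → ℂ} (hh : Continuous h) :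
    Integrable (fun x => (uniformDensity x : ℂ) * h x) := by
  rw [uniformDensity_mul_eq_indicator, integrable_indicator_iff measurableSet_Icc]
  exact Continuous.integrableOn_Icc (by fun_prop)

lemma integral_uniformDensity_mul (h : ℝ → ℂ) :
    ∫ x, (uniformDensity x : ℂ) * h x = 1 / 2 * ∫ x in (-1 : ℝ)..1, h x := by
  rw [uniformDensity_mul_eq_indicator, integral_indicator measurableSet_Icc, integral_const_mul,
    intervalIntegral.integral_of_le (by norm_num), integral_Icc_eq_integral_Ioc]

lemma uniformMGF_zero : uniformMGF 0 = 1 := by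
  rw [uniformMGF, integral_uniformDensity_mul]
  simp; norm_num

lemma uniformMGF_of_ne_zero {z : ℂ} (hz : z ≠ 0) : uniformMGF z = Complex.sinh z / z := by
  rw [uniformMGF, integral_uniformDensity_mul, integral_exp_mul_complex hz, Complex.sinh]
  simp; ring

lemma mul_uniformMGF (z : ℂ) : z * uniformMGF z = Complex.sinh z := by
  rcases eq_or_ne z 0 with rfl | hz
  · simp
  · rw [uniformMGF_of_ne_zero hz]; field_simp

lemma uniformMGF_mul_I (w : ℝ) : uniformMGF (w * Complex.I) = Real.sinc w := by
  rcases eq_or_ne w 0 with rfl | hw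
  · simp [uniformMGF_zero]
  · rw [uniformMGF_of_ne_zero (by simp [hw]), Complex.sinh_mul_I, Real.sinc_of_ne_zero hw]
    push_cast
    field_simp

lemma continuous_uniformMGF : Continuous uniformMGF := by
  have : uniformMGF = fun z : ℂ => 1 / 2 * ∫ x in (-1 : ℝ)..1, Complex.exp (z * x) := by
    ext z; rw [uniformMGF, integral_uniformDensity_mul]
  rw [this]
  refine continuous_const.mul ?_
  exact intervalIntegral.continuous_parametric_intervalIntegral_of_continuous'
    (by fun_prop) _ _

lemma norm_sinh_sq (t w : ℝ) :
    ‖Complex.sinh (t + w * Complex.I)‖ ^ 2 = Real.sinh t ^ 2 + Real.sin w ^ 2 := by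
  rw [Complex.sinh_add, Complex.sinh_mul_I, Complex.cosh_mul_I, ← Complex.normSq_eq_norm_sq,
    ← Complex.ofReal_sinh, ← Complex.ofReal_cosh, ← Complex.ofReal_sin, ← Complex.ofReal_cos,
    Complex.normSq_apply]
  simp
  rw [← Complex.ofReal_sinh, ← Complex.ofReal_cos, ← Complex.ofReal_sin]
  simp only [Complex.ofReal_re]
  have h1 := Real.cosh_sq t
  have h2 := Real.sin_sq_add_cos_sq w
  linear_combination Real.sin w ^ 2 * h1 + Real.sinh t ^ 2 * h2

/-- The form without division also covers `t = w = 0`. -/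
lemma norm_uniformMGF_sq_mul (t w : ℝ) :
    ‖uniformMGF (t + w * Complex.I)‖ ^ 2 * (t ^ 2 + w ^ 2) = Real.sinh t ^ 2 + Real.sin w ^ 2 := by
  rw [← norm_sinh_sq, ← mul_uniformMGF, norm_mul, mul_pow, mul_comm,
    ← Complex.normSq_eq_norm_sq (t + w * Complex.I), Complex.normSq_add_mul_I]

/-! ### Continuity and exponential tilting of the convolution powers -/

lemma integrable_uniformDensity : Integrable uniformDensity := by
  rw [uniformDensity, integrable_indicator_iff measurableSet_Icc]
  exact Continuous.integrableOn_Icc (by fun_prop)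

lemma uniformDensity_nonneg (x : ℝ) : 0 ≤ uniformDensity x :=
  Set.indicator_nonneg (fun _ _ => by norm_num) x

lemma uniformDensity_le (x : ℝ) : uniformDensity x ≤ 1 / 2 := by
  unfold uniformDensity
  exact Set.indicator_le_self' (fun _ _ => by norm_num) x |>.trans le_rfl

lemma measurable_uniformDensity : Measurable uniformDensity :=
  measurable_const.indicator measurableSet_Icc

lemma continuousAt_uniformDensity {x : ℝ} (h1 : x ≠ -1) (h2 : x ≠ 1) :
    ContinuousAt uniformDensity x := by
  refine continuous_const.continuousOn.continuousAt_indicator ?_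
  rw [frontier_Icc (by norm_num)]
  simp [h1, h2]

/-- The level set is a proper affine subspace, hence null. -/
lemma volume_sum_eq_zero {n : ℕ} (hn : n ≠ 0) (c : ℝ) :
    volume {x : Fin n → ℝ | ∑ i, x i = c} = 0 := by
  obtain ⟨m, rfl⟩ := Nat.exists_eq_succ_of_ne_zero hn
  let ℓ : (Fin (m + 1) → ℝ) →ₗ[ℝ] ℝ := ∑ i, LinearMap.proj i
  let A : AffineSubspace ℝ (Fin (m + 1) → ℝ) :=
    (AffineSubspace.mk' c (⊥ : Submodule ℝ ℝ)).comap ℓ.toAffineMap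
  have hA : ∀ x, x ∈ A ↔ ∑ i, x i = c := by
    intro x
    simp [A, ℓ, AffineSubspace.mem_mk', sub_eq_zero]
  have hs : (A : Set (Fin (m + 1) → ℝ)) = {x | ∑ i, x i = c} := by
    ext x; exact hA x
  rw [← hs]
  refine Measure.addHaar_affineSubspace _ _ fun htop => ?_
  have h0 := (hA (fun i => if i = 0 then c + 1 else 0)).1 (by rw [htop]; trivial)
  simp at h0

/-- Dominated convergence: at a given `s` the integrand can jump only for `x` on the two null
hyperplanes `s - ∑ x i = ±1`. For `n = 0` the density itself jumps. -/
lemma continuous_sumDensity_uniformDensity {n : ℕ} (hn : n ≠ 0) :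
    Continuous (sumDensity uniformDensity n) := by
  rw [continuous_iff_continuousAt]
  intro s
  have hm := measurable_uniformDensity
  refine continuousAt_of_dominated (bound := fun x => (∏ i, uniformDensity (x i)) * (1 / 2))
    ?_ ?_ ?_ ?_
  · exact .of_forall fun s => Measurable.aestronglyMeasurable (by fun_prop)
  · refine .of_forall fun s => .of_forall fun x => ?_
    have := Finset.prod_nonneg fun i (_ : i ∈ Finset.univ) => uniformDensity_nonneg (x i)
    rw [Real.norm_of_nonneg (mul_nonneg this (uniformDensity_nonneg _))]
    exact mul_le_mul_of_nonneg_left (uniformDensity_le _) this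
  · exact (Integrable.fintype_prod (f := fun _ : Fin n => uniformDensity)
      fun _ => integrable_uniformDensity).mul_const _
  · have h1 : ∀ᵐ x : Fin n → ℝ, ∑ i, x i ≠ s + 1 := by
      simpa [ae_iff] using volume_sum_eq_zero hn _
    have h2 : ∀ᵐ x : Fin n → ℝ, ∑ i, x i ≠ s - 1 := by
      simpa [ae_iff] using volume_sum_eq_zero hn _
    filter_upwards [h1, h2] with x hx1 hx2
    refine continuousAt_const.mul (ContinuousAt.comp (f := fun s => s - ∑ i, x i)
      (continuousAt_uniformDensity ?_ ?_) (by fun_prop))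
    · contrapose! hx1; linarith
    · contrapose! hx2; linarith

/-- The arguments of the factors add up to `s`, so the exponential weights multiply to a constant.
-/
lemma sumDensity_uniformDensity_mul_exp (n : ℕ) (z : ℂ) (s : ℝ) :
    sumDensity (fun x => (uniformDensity x : ℂ) * Complex.exp (z * x)) n s =
      Complex.exp (z * s) * ((sumDensity uniformDensity n s : ℝ) : ℂ) := by
  simp only [sumDensity]
  rw [← integral_complex_ofReal, ← integral_const_mul]
  refine integral_congr_ae (.of_forall fun x => ?_)
  simp only [Finset.prod_mul_distrib, ← Complex.exp_sum, Complex.ofReal_mul, Complex.ofReal_prod]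
  have : Complex.exp (z * s) =
      Complex.exp (∑ i, z * x i) * Complex.exp (z * ((s - ∑ i, x i : ℝ) : ℂ)) := by
    rw [← Complex.exp_add, ← Finset.mul_sum]
    push_cast
    ring_nf
  rw [this]
  ring

lemma integrable_exp_mul_sumDensity (n : ℕ) (z : ℂ) :
    Integrable fun s : ℝ => Complex.exp (z * s) * ((sumDensity uniformDensity n s : ℝ) : ℂ) := by
  simp_rw [← sumDensity_uniformDensity_mul_exp]
  exact integrable_sumDensity (integrable_uniformDensity_mul (by fun_prop)) n

lemma integral_exp_mul_sumDensity (n : ℕ) (z : ℂ) :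
    ∫ s : ℝ, Complex.exp (z * s) * ((sumDensity uniformDensity n s : ℝ) : ℂ) =
      uniformMGF z ^ (n + 1) := by
  simp_rw [← sumDensity_uniformDensity_mul_exp]
  exact integral_sumDensity (integrable_uniformDensity_mul (by fun_prop)) n

lemma meanDensity_succ (n : ℕ) (u : ℝ) :
    meanDensity (n + 1) u = (n + 1 : ℕ) * sumDensity uniformDensity n ((n + 1 : ℕ) * u) := rfl


/-! ### Size of the moment generating function on vertical lines -/

lemma one_le_norm_uniformMGF (t : ℝ) : 1 ≤ ‖uniformMGF t‖ := by
  rcases eq_or_ne t 0 with rfl | ht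
  · simp [uniformMGF_zero]
  · rw [uniformMGF_of_ne_zero (by exact_mod_cast ht), ← Complex.ofReal_sinh, ← Complex.ofReal_div,
      Complex.norm_real, norm_div, one_le_div (norm_pos_iff.2 ht), Real.norm_eq_abs,
      Real.norm_eq_abs, Real.abs_sinh]
    exact Real.self_le_sinh_iff.2 (abs_nonneg t)

/-- After multiplication by `t² + w²` the claim reads `sinh² t + sin² w < |M(t)|² (t² + w²)`, which
follows from `|M(t)|² t² = sinh² t`, `sin² w < w²` and `|M(t)| ≥ 1`. -/
lemma norm_uniformMGF_lt (t : ℝ) {w : ℝ} (hw : w ≠ 0) :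
    ‖uniformMGF (t + w * Complex.I)‖ < ‖uniformMGF t‖ := by
  have h0 := norm_uniformMGF_sq_mul t 0
  have h1 := norm_uniformMGF_sq_mul t w
  simp only [Complex.ofReal_zero, zero_mul, add_zero, Real.sin_zero, ne_eq, OfNat.ofNat_ne_zero,
    not_false_eq_true, zero_pow] at h0
  have h2 : Real.sin w ^ 2 < w ^ 2 := sq_lt_sq.2 (Real.abs_sin_lt_abs hw)
  have h3 := one_le_norm_uniformMGF t
  have hw2 : 0 < w ^ 2 := by positivity
  refine lt_of_pow_lt_pow_left₀ 2 (norm_nonneg _) ?_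
  refine lt_of_mul_lt_mul_right (a := t ^ 2 + w ^ 2) ?_ (by positivity)
  have h4 : (1 : ℝ) ≤ ‖uniformMGF t‖ ^ 2 := one_le_pow₀ h3
  nlinarith

lemma norm_uniformMGF_le (t w : ℝ) :
    ‖uniformMGF (t + w * Complex.I)‖ ≤ ‖uniformMGF t‖ := by
  rcases eq_or_ne w 0 with rfl | hw
  · simp
  · exact (norm_uniformMGF_lt t hw).le

lemma norm_uniformMGF_sq_le (t w : ℝ) :
    ‖uniformMGF (t + w * Complex.I)‖ ^ 2 ≤
      (‖uniformMGF t‖ ^ 2 + Real.sinh t ^ 2 + 1) * (1 + w ^ 2)⁻¹ := by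
  -- In the factor `1 + w²`, the `1` costs `‖M(t)‖²` and the `w²` costs at most `sinh² t + 1`.
  rw [← div_eq_mul_inv, le_div_iff₀ (by positivity)]
  have h1 := norm_uniformMGF_sq_mul t w
  have h2 : ‖uniformMGF (t + w * Complex.I)‖ ^ 2 ≤ ‖uniformMGF t‖ ^ 2 :=
    pow_le_pow_left₀ (norm_nonneg _) (norm_uniformMGF_le t w) 2
  have h3 := Real.sin_sq_le_one w
  have h4 : 0 ≤ ‖uniformMGF (t + w * Complex.I)‖ ^ 2 * t ^ 2 := by positivity
  nlinarith

/-- Powers `≥ 2` of a bounded function that decays like `1 / w` are integrable. -/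
lemma integrable_pow_of_sq_le {φ : ℝ → ℂ} (hφ : Continuous φ) {A C : ℝ} (hA : ∀ w, ‖φ w‖ ≤ A)
    (hC : ∀ w, ‖φ w‖ ^ 2 ≤ C * (1 + w ^ 2)⁻¹) {N : ℕ} (hN : 2 ≤ N) :
    Integrable fun w => φ w ^ N := by
  refine Integrable.mono' ((integrable_inv_one_add_sq.const_mul C).const_mul (A ^ (N - 2)))
    (by fun_prop) (.of_forall fun w => ?_)
  obtain ⟨k, rfl⟩ := Nat.exists_eq_add_of_le' hN
  rw [norm_pow, pow_add, Nat.add_sub_cancel]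
  have hA0 := (norm_nonneg _).trans (hA w)
  exact mul_le_mul (pow_le_pow_left₀ (norm_nonneg _) (hA w) k) (hC w) (by positivity)
    (by positivity)

lemma integrable_uniformMGF_pow (t : ℝ) {N : ℕ} (hN : 2 ≤ N) :
    Integrable fun w : ℝ => uniformMGF (t + w * Complex.I) ^ N :=
  integrable_pow_of_sq_le (φ := fun w : ℝ => uniformMGF (t + w * Complex.I))
    (continuous_uniformMGF.comp (by fun_prop)) (norm_uniformMGF_le t) (norm_uniformMGF_sq_le t) hN

/-! ### Fourier inversion and the law of the mean -/

open FourierTransform in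
/-- Fourier inversion on the vertical line of abscissa `t`. -/
lemma exp_mul_sumDensity_eq_integral {n : ℕ} (hn : n ≠ 0) (t s : ℝ) :
    Complex.exp (t * s) * ((sumDensity uniformDensity n s : ℝ) : ℂ) =
      1 / (2 * Real.pi) * ∫ w : ℝ, uniformMGF (t + w * Complex.I) ^ (n + 1) *
        Complex.exp (-(Complex.I * w * s)) := by
  set h : ℝ → ℂ := fun s =>
    Complex.exp (t * s) * ((sumDensity uniformDensity n s : ℝ) : ℂ) with hh
  -- The kernel `exp (-2πi v ξ)` of `𝓕` corresponds to `w = -2πξ`; this substitution later produces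
  -- the factor `1 / (2π)`.
  have hF : ∀ ξ : ℝ, 𝓕 h ξ =
      uniformMGF (t + ((-(2 * Real.pi) * ξ : ℝ) : ℂ) * Complex.I) ^ (n + 1) := by
    intro ξ
    rw [Real.fourier_real_eq_integral_exp_smul, ← integral_exp_mul_sumDensity]
    refine integral_congr_ae (.of_forall fun v => ?_)
    simp only [hh, smul_eq_mul]
    rw [← mul_assoc, ← Complex.exp_add]
    congr 2
    push_cast
    ring
  have h2pi : -(2 * Real.pi) ≠ 0 := by simp [Real.pi_ne_zero]
  have hcont : Continuous h := by
    have := continuous_sumDensity_uniformDensity hn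
    simp only [hh]
    fun_prop
  have hint : Integrable h := integrable_exp_mul_sumDensity n t
  have hFint : Integrable (𝓕 h) := by
    rw [funext hF]
    exact (integrable_uniformMGF_pow t (by lia)).comp_mul_left' h2pi
  have key := congrFun (hcont.fourierInv_fourier_eq hint hFint) s
  change h s = _
  rw [← key, Real.fourierInv_eq']
  have := Measure.integral_comp_mul_left (fun w : ℝ => uniformMGF (t + w * Complex.I) ^ (n + 1) *
        Complex.exp (-(Complex.I * w * s))) (-(2 * Real.pi))
  rw [abs_of_neg (inv_lt_zero.2 (by linarith [Real.pi_pos])), Complex.real_smul] at this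
  trans ∫ ξ : ℝ, uniformMGF (t + ((-(2 * Real.pi) * ξ : ℝ) : ℂ) * Complex.I) ^ (n + 1) *
        Complex.exp (-(Complex.I * ((-(2 * Real.pi) * ξ : ℝ) : ℂ) * s))
  · refine integral_congr_ae (.of_forall fun ξ => ?_)
    simp only [hF, smul_eq_mul]
    rw [mul_comm]
    congr 2
    simp
    ring
  · rw [this]
    congr 1
    push_cast
    rw [inv_neg, neg_neg, one_div]

lemma sumDensity_uniformDensity_nonneg (n : ℕ) (s : ℝ) : 0 ≤ sumDensity uniformDensity n s :=
  integral_nonneg fun _ => mul_nonneg (Finset.prod_nonneg fun _ _ => uniformDensity_nonneg _)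
    (uniformDensity_nonneg _)

lemma meanDensity_nonneg (N : ℕ) (u : ℝ) : 0 ≤ meanDensity N u :=
  mul_nonneg (Nat.cast_nonneg N) (sumDensity_uniformDensity_nonneg (N - 1) (N * u))

lemma continuous_meanDensity {N : ℕ} (hN : 2 ≤ N) : Continuous (meanDensity N) := by
  have := continuous_sumDensity_uniformDensity (n := N - 1) (by lia)
  exact continuous_const.mul (this.comp (continuous_const.mul continuous_id))

lemma integral_exp_mul_meanDensity (n : ℕ) (z : ℂ) :
    Integrable (fun u : ℝ => Complex.exp (z * u) * (meanDensity (n + 1) u : ℂ)) ∧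
    ∫ u : ℝ, Complex.exp (z * u) * (meanDensity (n + 1) u : ℂ) =
      uniformMGF (z / (n + 1 : ℕ)) ^ (n + 1) := by
  have hN : ((n + 1 : ℕ) : ℝ) ≠ 0 := by positivity
  have hNc : ((n + 1 : ℕ) : ℂ) ≠ 0 := by exact_mod_cast hN
  set F : ℝ → ℂ := fun s => Complex.exp (z / (n + 1 : ℕ) * s) *
    ((sumDensity uniformDensity n s : ℝ) : ℂ) with hF
  have heq : (fun u : ℝ => Complex.exp (z * u) * (meanDensity (n + 1) u : ℂ)) =
      fun u => ((n + 1 : ℕ) : ℂ) * F ((n + 1 : ℕ) * u) := by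
    ext u
    rw [meanDensity_succ, hF]
    simp only [Complex.ofReal_mul, Complex.ofReal_natCast]
    rw [show z / ((n + 1 : ℕ) : ℂ) * (((n + 1 : ℕ) : ℂ) * u) = z * u by field_simp]
    ring
  rw [heq]
  have hi : Integrable F := integrable_exp_mul_sumDensity n _
  refine ⟨(hi.comp_mul_left' hN).const_mul _, ?_⟩
  rw [integral_const_mul, Measure.integral_comp_mul_left F, Complex.real_smul,
    abs_of_pos (by positivity), ← mul_assoc, Complex.ofReal_inv, Complex.ofReal_natCast,
    mul_inv_cancel₀ hNc, one_mul]
  exact integral_exp_mul_sumDensity n _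

lemma charFun_cond_Icc (t : ℝ) :
    ∫ x : ℝ, Complex.exp (t * x * Complex.I) ∂(cond (volume : Measure ℝ) (Set.Icc (-1) 1)) =
      uniformMGF (t * Complex.I) := by
  rw [ProbabilityTheory.cond, integral_smul_measure, uniformMGF, integral_uniformDensity_mul,
    intervalIntegral.integral_of_le (by norm_num), integral_Icc_eq_integral_Ioc, Real.volume_Icc]
  rw [Complex.real_smul]
  congr 1
  · norm_num
  · simp_rw [mul_right_comm]

lemma charFun_uniformMeanLaw (N : ℕ) (t : ℝ) :
    charFun (uniformMeanLaw N) t = uniformMGF (t * Complex.I / N) ^ N := by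
  rw [charFun_apply_real, uniformMeanLaw, integral_map (by fun_prop) (by fun_prop)]
  have : ∀ x : Fin N → ℝ, Complex.exp (t * ((∑ i, x i) / N : ℝ) * Complex.I) =
      ∏ i, Complex.exp ((t / N : ℝ) * x i * Complex.I) := by
    intro x
    rw [← Complex.exp_sum, ← Finset.sum_mul, ← Finset.mul_sum]
    push_cast
    ring_nf
  have h0 : (volume : Measure ℝ) (Set.Icc (-1) 1) ≠ 0 := by simp
  have hp : IsProbabilityMeasure (cond (volume : Measure ℝ) (Set.Icc (-1) 1)) :=
    ProbabilityTheory.cond_isProbabilityMeasure_of_finite h0 (by simp)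
  simp_rw [this]
  rw [integral_fintype_prod_eq_pow (fun x : ℝ => Complex.exp ((t / N : ℝ) * x * Complex.I)),
    charFun_cond_Icc, Fintype.card_fin]
  push_cast
  rw [div_mul_eq_mul_div]

/-- Both sides are finite measures with characteristic function `M(it / N) ^ N`. -/
lemma uniformMeanLaw_eq_withDensity {N : ℕ} (hN : 2 ≤ N) :
    uniformMeanLaw N = volume.withDensity (fun u => ENNReal.ofReal (meanDensity N u)) := by
  have hp : IsProbabilityMeasure (cond (volume : Measure ℝ) (Set.Icc (-1) 1)) :=
    ProbabilityTheory.cond_isProbabilityMeasure_of_finite (by simp) (by simp)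
  have h1 : IsProbabilityMeasure (uniformMeanLaw N) :=
    Measure.isProbabilityMeasure_map (by fun_prop)
  obtain ⟨n, rfl⟩ : ∃ n, N = n + 1 := ⟨N - 1, by lia⟩
  -- The exponent `z = 0` gives integrability of the density itself.
  have hi : Integrable (meanDensity (n + 1)) := by
    have := (integral_exp_mul_meanDensity n 0).1.re
    simpa using this
  have h2 := isFiniteMeasure_withDensity_ofReal hi.2
  refine Measure.ext_of_charFun (funext fun t => ?_)
  rw [charFun_uniformMeanLaw, charFun_apply_real, ← (integral_exp_mul_meanDensity n _).2]
  have hm : Measurable fun u => (meanDensity (n + 1) u).toNNReal :=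
    (continuous_meanDensity hN).measurable.real_toNNReal
  refine Eq.symm ((integral_withDensity_eq_integral_smul hm _).trans ?_)
  refine integral_congr_ae (.of_forall fun u => ?_)
  simp only [NNReal.smul_def, Real.coe_toNNReal _ (meanDensity_nonneg _ _), Complex.real_smul]
  rw [mul_comm, mul_right_comm]

/-- The factor undoing the tilt is moved inside the integral, so that the integrand is the `N`-th
power of a function independent of `N`, with `t` still free. -/
lemma meanDensity_eq_integral {N : ℕ} (hN : 2 ≤ N) (t u : ℝ) :
    (meanDensity N u : ℂ) = N / (2 * Real.pi) * ∫ w : ℝ,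
      (uniformMGF (t + w * Complex.I) * Complex.exp (-((t + w * Complex.I) * u))) ^ N := by
  obtain ⟨n, rfl⟩ : ∃ n, N = n + 1 := ⟨N - 1, by lia⟩
  have h := exp_mul_sumDensity_eq_integral (n := n) (by lia) t ((n + 1 : ℕ) * u)
  have he : ∀ w : ℝ,
      (uniformMGF (t + w * Complex.I) * Complex.exp (-((t + w * Complex.I) * u))) ^ (n + 1) =
      Complex.exp (-(t * ((n + 1 : ℕ) * u : ℝ))) * (uniformMGF (t + w * Complex.I) ^ (n + 1) *
        Complex.exp (-(Complex.I * w * ((n + 1 : ℕ) * u : ℝ)))) := by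
    intro w
    rw [mul_pow, ← Complex.exp_nat_mul, mul_left_comm, ← Complex.exp_add]
    congr 2
    push_cast
    ring
  simp_rw [he]
  rw [integral_const_mul, meanDensity_succ, Complex.ofReal_mul, Complex.exp_neg]
  rw [mul_comm, ← eq_div_iff (Complex.exp_ne_zero _)] at h
  rw [h]
  push_cast
  ring

lemma integrable_sinc_pow_mul_exp {N : ℕ} (hN : 2 ≤ N) (u : ℝ) :
    Integrable fun w : ℝ =>
      (Real.sinc (w / N) : ℂ) ^ N * Complex.exp (-(Complex.I * w * u)) := by
  have hN0 : (N : ℝ)⁻¹ ≠ 0 := by positivity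
  have h := (integrable_uniformMGF_pow 0 hN).comp_mul_left' hN0
  refine (h.bdd_mul (c := 1) (f := fun w : ℝ => Complex.exp (-(Complex.I * w * u)))
    (by fun_prop) (.of_forall fun w => ?_)).congr (.of_forall fun w => ?_)
  · rw [show -(Complex.I * w * u) = ((-(w * u) : ℝ) : ℂ) * Complex.I by push_cast; ring,
      Complex.norm_exp_ofReal_mul_I]
  · simp only [Complex.ofReal_zero, zero_add, uniformMGF_mul_I]
    rw [mul_comm, inv_mul_eq_div]

lemma meanDensity_eq_integral_sinc {N : ℕ} (hN : 2 ≤ N) (u : ℝ) :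
    (meanDensity N u : ℂ) = 1 / (2 * Real.pi) *
      ∫ w : ℝ, (Real.sinc (w / N) : ℂ) ^ N * Complex.exp (-(Complex.I * w * u)) := by
  have hN0 : (N : ℂ) ≠ 0 := by norm_cast; lia
  have h := Measure.integral_comp_div
    (fun w : ℝ => (Real.sinc w : ℂ) ^ N * Complex.exp (-(Complex.I * (N * w) * u))) (N : ℝ)
  rw [meanDensity_eq_integral hN 0 u]
  trans 1 / (2 * Real.pi) * ((N : ℂ) *
    ∫ w : ℝ, (Real.sinc w : ℂ) ^ N * Complex.exp (-(Complex.I * (N * w) * u)))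
  · rw [← mul_assoc, one_div_mul_eq_div]
    congr 1
    refine integral_congr_ae (.of_forall fun w => ?_)
    simp only [Complex.ofReal_zero, zero_add, uniformMGF_mul_I]
    rw [mul_pow, ← Complex.exp_nat_mul]
    congr 2
    ring
  · congr 1
    rw [Nat.abs_cast, Complex.real_smul, Complex.ofReal_natCast] at h
    rw [← h]
    refine integral_congr_ae (.of_forall fun w => ?_)
    simp only
    congr 4
    push_cast
    field_simp


/-! ### Laplace's method for powers of a characteristic function -/

/-- Telescoping. The factor `r ^ n` matters: with `r = exp (-(a / 2) w²)` it supplies the Gaussian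
decay. -/
lemma norm_pow_sub_pow_le_of_norm_le {x y : ℂ} {r : ℝ} (hx : ‖x‖ ≤ r) (hy : ‖y‖ ≤ r) (n : ℕ) :
    ‖x ^ (n + 1) - y ^ (n + 1)‖ ≤ (n + 1) * r ^ n * ‖x - y‖ := by
  have hr := (norm_nonneg x).trans hx
  induction n with
  | zero => simp
  | succ n ih =>
    have : x ^ (n + 1 + 1) - y ^ (n + 1 + 1) =
        x * (x ^ (n + 1) - y ^ (n + 1)) + (x - y) * y ^ (n + 1) := by ring
    rw [this]
    refine (norm_add_le _ _).trans ?_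
    rw [norm_mul, norm_mul, norm_pow]
    have h1 := mul_le_mul hx ih (norm_nonneg _) hr
    have h2 := mul_le_mul_of_nonneg_left (pow_le_pow_left₀ (norm_nonneg y) hy (n + 1))
      (norm_nonneg (x - y))
    push_cast
    calc _ ≤ r * ((n + 1) * r ^ n * ‖x - y‖) + ‖x - y‖ * r ^ (n + 1) := add_le_add h1 h2
      _ = _ := by ring

/-- The exponential of a cubic polynomial without constant and linear terms, with the real
and imaginary parts of the Taylor polynomial of the logarithm of a centred characteristic
function. -/
noncomputable def cubicExp (a k w : ℝ) : ℂ :=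
  Complex.exp (((-a * w ^ 2 : ℝ) : ℂ) + ((k * w ^ 3 : ℝ) : ℂ) * Complex.I)

lemma norm_cubicExp (a k w : ℝ) : ‖cubicExp a k w‖ = Real.exp (-a * w ^ 2) := by
  rw [cubicExp, Complex.norm_exp, Complex.add_re, Complex.re_ofReal_mul, Complex.I_re,
    Complex.ofReal_re]
  simp

lemma cubicExp_pow (a k w : ℝ) (N : ℕ) : cubicExp a k w ^ N = cubicExp (N * a) (N * k) w := by
  rw [cubicExp, cubicExp, ← Complex.exp_nat_mul]
  congr 1
  push_cast
  ring

/-- The real part contains the cubic term only as `cos (k w³)`, and `1 - cos x ≤ x² / 2`. -/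
lemma abs_re_cubicExp_sub_le (a k w : ℝ) :
    |(cubicExp a k w).re - Real.exp (-a * w ^ 2)| ≤
      k ^ 2 / 2 * w ^ 6 * Real.exp (-a * w ^ 2) := by
  have : (cubicExp a k w).re = Real.exp (-a * w ^ 2) * Real.cos (k * w ^ 3) := by
    rw [cubicExp, Complex.exp_add, ← Complex.ofReal_exp, Complex.re_ofReal_mul,
      Complex.exp_ofReal_mul_I_re]
  rw [this]
  have h1 := Real.cos_le_one (k * w ^ 3)
  have h2 := Real.one_sub_sq_div_two_le_cos (x := k * w ^ 3)
  have h3 := Real.exp_pos (-a * w ^ 2)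
  rw [abs_of_nonpos (by nlinarith)]
  calc _ = Real.exp (-a * w ^ 2) * (1 - Real.cos (k * w ^ 3)) := by ring
    _ ≤ Real.exp (-a * w ^ 2) * ((k * w ^ 3) ^ 2 / 2) := by gcongr; linarith
    _ = _ := by ring

lemma exists_local_bounds {φ : ℝ → ℂ} {a k C δ₀ : ℝ} (ha : 0 < a) (hC : 0 ≤ C) (hδ₀ : 0 < δ₀)
    (hT : ∀ w, |w| ≤ δ₀ →
      ‖φ w - (1 + ((-a * w ^ 2 : ℝ) + (k * w ^ 3 : ℝ) * Complex.I))‖ ≤ C * w ^ 4) :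
    ∃ δ > 0, ∃ D ≥ 0, ∀ w, |w| ≤ δ →
      ‖φ w - cubicExp a k w‖ ≤ D * w ^ 4 ∧ ‖φ w‖ ≤ Real.exp (-(a / 2) * w ^ 2) := by
  have hk := abs_nonneg k
  -- The third bound makes the exponent `z` of `cubicExp` satisfy `‖z‖ ≤ 1`; the fourth lets half of
  -- `a w²` absorb the cubic and quartic terms. In `D`, `C` is the Taylor error and `(a + |k|) ^ 2`
  -- comes from `‖exp z - 1 - z‖ ≤ ‖z‖²`.
  refine ⟨min δ₀ (min 1 (min (1 / (a + |k|)) (a / 2 / (|k| + C + 1)))), by positivity,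
    C + (a + |k|) ^ 2, by positivity, fun w hw => ?_⟩
  simp only [le_min_iff] at hw
  obtain ⟨hw0, hw1, hw2, hw3⟩ := hw
  rw [le_div_iff₀ (by positivity)] at hw2 hw3
  have hw := abs_nonneg w
  have hsq : w ^ 2 = |w| ^ 2 := (sq_abs w).symm
  have hw21 : w ^ 2 ≤ |w| := by rw [hsq]; nlinarith
  have hcub : |w ^ 3| ≤ |w| * w ^ 2 := by rw [abs_pow, hsq]; exact le_of_eq (by ring)
  have hw2' : 0 ≤ w ^ 2 := sq_nonneg w
  have hTw := hT w hw0
  set z : ℂ := ((-a * w ^ 2 : ℝ) : ℂ) + ((k * w ^ 3 : ℝ) : ℂ) * Complex.I with hz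
  have hkw : ‖((k * w ^ 3 : ℝ) : ℂ) * Complex.I‖ ≤ |k| * (|w| * w ^ 2) := by
    rw [norm_mul, Complex.norm_I, mul_one, Complex.norm_real, Real.norm_eq_abs, abs_mul]
    gcongr
  have hnz : ‖z‖ ≤ (a + |k|) * w ^ 2 := by
    refine (norm_add_le _ _).trans ?_
    have h1 : ‖((-a * w ^ 2 : ℝ) : ℂ)‖ = a * w ^ 2 := by
      rw [Complex.norm_real, Real.norm_eq_abs, abs_mul, abs_neg, abs_of_pos ha, abs_of_nonneg hw2']
    have h2 : |w| * w ^ 2 ≤ 1 * w ^ 2 := by gcongr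
    have h3 := mul_le_mul_of_nonneg_left h2 hk
    linarith
  have hz1 : ‖z‖ ≤ 1 := by
    have : (a + |k|) * w ^ 2 ≤ (a + |k|) * |w| := by gcongr
    linarith
  constructor
  · have h1 := Complex.norm_exp_sub_one_sub_id_le hz1
    have h2 : ‖z‖ ^ 2 ≤ ((a + |k|) * w ^ 2) ^ 2 := by gcongr
    have : φ w - cubicExp a k w = (φ w - (1 + z)) - (Complex.exp z - 1 - z) := by
      rw [cubicExp, ← hz]; ring
    rw [this]
    refine (norm_sub_le _ _).trans ?_
    calc _ ≤ C * w ^ 4 + ((a + |k|) * w ^ 2) ^ 2 := add_le_add hTw (h1.trans h2)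
      _ = _ := by ring
  · have h1 : φ w = (φ w - (1 + z)) + ((1 - a * w ^ 2 : ℝ) : ℂ) +
        ((k * w ^ 3 : ℝ) : ℂ) * Complex.I := by
      rw [hz]; push_cast; ring
    have haw : a * w ^ 2 ≤ 1 := by
      have : (a + |k|) * w ^ 2 ≤ (a + |k|) * |w| := by gcongr
      have : 0 ≤ |k| * w ^ 2 := by positivity
      linarith
    have h2 : ‖((1 - a * w ^ 2 : ℝ) : ℂ)‖ = 1 - a * w ^ 2 := by
      rw [Complex.norm_real, Real.norm_of_nonneg (by linarith)]
    have h3 : ‖φ w‖ ≤ C * w ^ 4 + (1 - a * w ^ 2) + |k| * (|w| * w ^ 2) := by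
      conv_lhs => rw [h1]
      refine (norm_add₃_le).trans ?_
      rw [h2]
      gcongr
    have h4 : C * w ^ 4 ≤ C * (|w| * w ^ 2) := by
      gcongr
      calc w ^ 4 = w ^ 2 * w ^ 2 := by ring
        _ ≤ |w| * w ^ 2 := by gcongr
    have h5 : (C + |k|) * |w| * w ^ 2 ≤ a / 2 * w ^ 2 := by
      gcongr
      nlinarith
    have h6 := Real.add_one_le_exp (-(a / 2) * w ^ 2)
    nlinarith

/-- The decay hypothesis gives `1 / 2` beyond radius `R`; on the remaining compact annulus `‖φ‖`
attains its maximum, which is below `1`. -/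
lemma exists_tail_bound {φ : ℝ → ℂ} (hφ : Continuous φ) (hlt : ∀ w, w ≠ 0 → ‖φ w‖ < 1)
    {A : ℝ} (hA : ∀ w, ‖φ w‖ ^ 2 ≤ A * (1 + w ^ 2)⁻¹) {δ : ℝ} (hδ : 0 < δ) :
    ∃ q, 0 ≤ q ∧ q < 1 ∧ ∀ w, δ ≤ |w| → ‖φ w‖ ≤ q := by
  set R := 4 * |A| + 1 with hR
  have hA0 := abs_nonneg A
  have hfar : ∀ w, R ≤ |w| → ‖φ w‖ ≤ 1 / 2 := by
    intro w hw
    have h1 := hA w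
    rw [← div_eq_mul_inv, le_div_iff₀ (by positivity)] at h1
    have h2 : R ^ 2 ≤ w ^ 2 := by rw [← sq_abs w]; gcongr
    have h3 := le_abs_self A
    by_contra! h
    have h4 : (1 / 2 : ℝ) ^ 2 ≤ ‖φ w‖ ^ 2 := by gcongr
    nlinarith
  have hcpt : IsCompact (Metric.closedBall (0 : ℝ) R \ Metric.ball 0 δ) :=
    (isCompact_closedBall 0 R).diff Metric.isOpen_ball
  rcases (Metric.closedBall (0 : ℝ) R \ Metric.ball 0 δ).eq_empty_or_nonempty with he | hne
  · refine ⟨1 / 2, by norm_num, by norm_num, fun w hw => hfar w ?_⟩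
    by_contra! h
    have : w ∈ Metric.closedBall (0 : ℝ) R \ Metric.ball 0 δ := by
      simp [hw, h.le]
    simp [he] at this
  · obtain ⟨m, hm, hmax⟩ := hcpt.exists_isMaxOn hne hφ.norm.continuousOn
    have hm0 : m ≠ 0 := by
      rintro rfl
      simp [hδ] at hm
    refine ⟨max (1 / 2) ‖φ m‖, by positivity, max_lt (by norm_num) (hlt m hm0), fun w hw => ?_⟩
    rcases le_total R |w| with h | h
    · exact (hfar w h).trans (le_max_left _ _)
    · exact (hmax (by simp [hw, h])).trans (le_max_right _ _)

/-- Makes the geometric tail `O(N⁻²)`, smaller than the admissible error of order `N ^ (-3/2)`. -/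
lemma exists_pow_mul_sq_le {q : ℝ} (hq0 : 0 ≤ q) (hq1 : q < 1) :
    ∃ B, ∀ N : ℕ, 2 ≤ N → q ^ (N - 2) * (N : ℝ) ^ 2 ≤ B := by
  obtain ⟨B, hB⟩ := (tendsto_pow_const_mul_const_pow_of_abs_lt_one 2
    (by rwa [abs_of_nonneg hq0])).bddAbove_range
  refine ⟨2 * B + 8, fun N hN => ?_⟩
  obtain ⟨m, rfl⟩ := Nat.exists_eq_add_of_le' hN
  have h1 : (m : ℝ) ^ 2 * q ^ m ≤ B := hB ⟨m, rfl⟩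
  have h2 : q ^ m ≤ 1 := pow_le_one₀ hq0 hq1.le
  have h3 : 0 ≤ q ^ m := by positivity
  rw [Nat.add_sub_cancel]
  push_cast
  -- Passing from `N = m + 2` to `m` here is the origin of `2 * B + 8`.
  have h4 : ((m : ℝ) + 2) ^ 2 ≤ 2 * m ^ 2 + 8 := by nlinarith [sq_nonneg ((m : ℝ) - 2)]
  nlinarith [mul_le_mul_of_nonneg_left h4 h3]

/-- The Gaussian-weighted error term in the rescaled variable. -/
noncomputable def gaussianError (b c d v : ℝ) : ℝ :=
  (c * v ^ 4 + d * v ^ 6) * Real.exp (-b * v ^ 2)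

lemma integrable_gaussianError {b : ℝ} (hb : 0 < b) (c d : ℝ) :
    Integrable (gaussianError b c d) := by
  have h4 := (integrable_rpow_mul_exp_neg_mul_sq hb (s := 4) (by norm_num)).const_mul c
  have h6 := (integrable_rpow_mul_exp_neg_mul_sq hb (s := 6) (by norm_num)).const_mul d
  refine (h4.add h6).congr (.of_forall fun v => ?_)
  simp only [Pi.add_apply, gaussianError]
  norm_cast
  ring

/-- Near `0` the powers are compared by telescoping; away from `0` both are small separately. The
two bounds are added, so that a single integrable majorant holds on the whole line. -/
lemma exists_pointwise_bound {φ : ℝ → ℂ} (hφ : Continuous φ) (hlt : ∀ w, w ≠ 0 → ‖φ w‖ < 1)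
    {A : ℝ} (hA : ∀ w, ‖φ w‖ ^ 2 ≤ A * (1 + w ^ 2)⁻¹)
    {a k C δ₀ : ℝ} (ha : 0 < a) (hC : 0 ≤ C) (hδ₀ : 0 < δ₀)
    (hT : ∀ w, |w| ≤ δ₀ →
      ‖φ w - (1 + ((-a * w ^ 2 : ℝ) + (k * w ^ 3 : ℝ) * Complex.I))‖ ≤ C * w ^ 4) :
    ∃ c q, 0 ≤ q ∧ q < 1 ∧ ∀ N : ℕ, 2 ≤ N → ∀ w,
      |(φ w ^ N).re - Real.exp (-(N * a) * w ^ 2)| ≤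
        (N : ℝ)⁻¹ * gaussianError (a / 4) c (k ^ 2 / 2) (√N * w) +
          q ^ (N - 2) * (A * (1 + w ^ 2)⁻¹) := by
  obtain ⟨δ, hδ, D, hD, hloc⟩ := exists_local_bounds ha hC hδ₀ hT
  obtain ⟨q, hq0, hq1, hq⟩ := exists_tail_bound hφ hlt hA hδ
  -- `D` serves `|w| ≤ δ`; the extra `1 / δ ^ 4` serves `|w| ≥ δ`, where `1 ≤ w⁴ / δ⁴` lets the
  -- quartic term dominate the Gaussian itself.
  refine ⟨D + 1 / δ ^ 4, q, hq0, hq1, fun N hN w => ?_⟩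
  have hN2 : (2 : ℝ) ≤ N := by exact_mod_cast hN
  have hw2 := sq_nonneg w
  -- The rate `a / 4` arises because telescoping leaves the power `N - 1 ≥ N / 2` of `exp (-(a / 2)
  -- w²)`.
  set e := Real.exp (-(N * (a / 4)) * w ^ 2) with he
  have he0 : 0 < e := Real.exp_pos _
  have hEe : Real.exp (-(N * a) * w ^ 2) ≤ e := by
    apply Real.exp_le_exp.2
    have : 0 ≤ N * a * w ^ 2 := by positivity
    nlinarith
  have hA' : 0 ≤ A * (1 + w ^ 2)⁻¹ := (sq_nonneg _).trans (hA w)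
  have hmain : ‖φ w ^ N - cubicExp a k w ^ N‖ ≤
      N * (D + 1 / δ ^ 4) * w ^ 4 * e + q ^ (N - 2) * (A * (1 + w ^ 2)⁻¹) := by
    rcases le_total |w| δ with h | h
    · obtain ⟨h1, h2⟩ := hloc w h
      obtain ⟨n, rfl⟩ : ∃ n, N = n + 1 := ⟨N - 1, by lia⟩
      have h3 : ‖cubicExp a k w‖ ≤ Real.exp (-(a / 2) * w ^ 2) := by
        rw [norm_cubicExp]
        apply Real.exp_le_exp.2
        nlinarith
      have h4 := norm_pow_sub_pow_le_of_norm_le h2 h3 n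
      have h5 : Real.exp (-(a / 2) * w ^ 2) ^ n ≤ e := by
        rw [← Real.exp_nat_mul, he]
        apply Real.exp_le_exp.2
        push_cast at hN2 ⊢
        have h6 : 0 ≤ a * w ^ 2 := by positivity
        nlinarith [mul_le_mul_of_nonneg_right hN2 h6]
      have h7 : ((n : ℝ) + 1) * Real.exp (-(a / 2) * w ^ 2) ^ n * ‖φ w - cubicExp a k w‖ ≤
          (n + 1) * e * (D * w ^ 4) := by gcongr
      have h8 : 0 ≤ ((n : ℝ) + 1) * (1 / δ ^ 4) * w ^ 4 * e := by positivity
      have h9 : 0 ≤ q ^ (n + 1 - 2) * (A * (1 + w ^ 2)⁻¹) := by positivity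
      rw [Nat.cast_succ]
      linarith
    · refine (norm_sub_le _ _).trans ?_
      rw [add_comm]
      refine add_le_add ?_ ?_
      · rw [cubicExp_pow, norm_cubicExp]
        refine hEe.trans ?_
        have h1 : δ ^ 4 ≤ w ^ 4 := by
          rw [← Even.pow_abs (by decide : Even 4) w]
          exact pow_le_pow_left₀ hδ.le h 4
        have h2 : 1 ≤ 1 / δ ^ 4 * w ^ 4 := by
          rw [one_div_mul_eq_div, le_div_iff₀ (by positivity)]
          linarith
        have h3 : 0 ≤ D * w ^ 4 := by positivity
        have h4 : 1 ≤ N * ((D + 1 / δ ^ 4) * w ^ 4) := by nlinarith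
        calc e = 1 * e := (one_mul e).symm
          _ ≤ N * ((D + 1 / δ ^ 4) * w ^ 4) * e := by gcongr
          _ = _ := by ring
      · obtain ⟨m, rfl⟩ := Nat.exists_eq_add_of_le' hN
        rw [norm_pow, pow_add, Nat.add_sub_cancel]
        exact mul_le_mul (pow_le_pow_left₀ (norm_nonneg _) (hq w h) m) (hA w) (by positivity)
          (by positivity)
  have hre : |(φ w ^ N).re - (cubicExp a k w ^ N).re| ≤ ‖φ w ^ N - cubicExp a k w ^ N‖ := by
    rw [← Complex.sub_re]; exact Complex.abs_re_le_norm _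
  have hcub := abs_re_cubicExp_sub_le (N * a) (N * k) w
  rw [← cubicExp_pow] at hcub
  have hcub' : (N * k) ^ 2 / 2 * w ^ 6 * Real.exp (-(N * a) * w ^ 2) ≤
      (N * k) ^ 2 / 2 * w ^ 6 * e := by
    gcongr
  have htri := abs_sub_le (φ w ^ N).re (cubicExp a k w ^ N).re (Real.exp (-(N * a) * w ^ 2))
  have hsN : √(N : ℝ) ^ 2 = N := Real.sq_sqrt (by positivity)
  have hG : (N : ℝ)⁻¹ * gaussianError (a / 4) (D + 1 / δ ^ 4) (k ^ 2 / 2) (√N * w) =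
      N * (D + 1 / δ ^ 4) * w ^ 4 * e + (N * k) ^ 2 / 2 * w ^ 6 * e := by
    rw [gaussianError, mul_pow, mul_pow, mul_pow, hsN, he,
      show √(N : ℝ) ^ 4 = (N : ℝ) ^ 2 by nth_rw 2 [← hsN]; ring,
      show √(N : ℝ) ^ 6 = (N : ℝ) ^ 3 by nth_rw 2 [← hsN]; ring,
      show -(a / 4) * (N * w ^ 2) = -(N * (a / 4)) * w ^ 2 by ring]
    field_simp
  rw [hG]
  linarith

/-- Laplace's method for powers of a characteristic function, with relative error `O(1 / N)`. -/
lemma exists_abs_integral_pow_sub_le {φ : ℝ → ℂ} (hφ : Continuous φ)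
    (hlt : ∀ w, w ≠ 0 → ‖φ w‖ < 1)
    {A : ℝ} (hA : ∀ w, ‖φ w‖ ^ 2 ≤ A * (1 + w ^ 2)⁻¹)
    {a k C δ₀ : ℝ} (ha : 0 < a) (hC : 0 ≤ C) (hδ₀ : 0 < δ₀)
    (hT : ∀ w, |w| ≤ δ₀ →
      ‖φ w - (1 + ((-a * w ^ 2 : ℝ) + (k * w ^ 3 : ℝ) * Complex.I))‖ ≤ C * w ^ 4) :
    ∃ K, ∀ N : ℕ, 2 ≤ N →
      |(∫ w, φ w ^ N).re - √(Real.pi / (N * a))| ≤ K * (1 / N) * √(Real.pi / (N * a)) := by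
  obtain ⟨c, q, hq0, hq1, hpt⟩ := exists_pointwise_bound hφ hlt hA ha hC hδ₀ hT
  obtain ⟨B, hB⟩ := exists_pow_mul_sq_le hq0 hq1
  have hA0 : 0 ≤ A := by
    have := (sq_nonneg _).trans (hA 0)
    simpa using this
  set P := ∫ v, gaussianError (a / 4) c (k ^ 2 / 2) v with hP
  set s := √(Real.pi / a) with hs
  have hs0 : 0 < s := Real.sqrt_pos.2 (by positivity)
  refine ⟨(P + B * (A * Real.pi)) / s, fun N hN => ?_⟩
  have hN0 : (0 : ℝ) < N := by positivity
  have hN1 : (1 : ℝ) ≤ N := by exact_mod_cast (by lia : 1 ≤ N)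
  have hsN : 0 < √(N : ℝ) := Real.sqrt_pos.2 hN0
  have hsplit : √(Real.pi / (N * a)) = s / √N := by
    rw [hs, ← Real.sqrt_div (by positivity), div_div, mul_comm a]
  have hle1 : ∀ w, ‖φ w‖ ≤ max 1 ‖φ 0‖ := by
    intro w
    rcases eq_or_ne w 0 with rfl | hw
    · exact le_max_right _ _
    · exact (hlt w hw).le.trans (le_max_left _ _)
  have hi1 := integrable_pow_of_sq_le hφ hle1 hA hN
  have hi2 : Integrable fun w : ℝ => Real.exp (-(N * a) * w ^ 2) :=
    integrable_exp_neg_mul_sq (by positivity)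
  have hi3 := ((integrable_gaussianError (by positivity : 0 < a / 4) c (k ^ 2 / 2)).comp_mul_left'
    hsN.ne').const_mul (N : ℝ)⁻¹
  have hi4 := (integrable_inv_one_add_sq.const_mul A).const_mul (q ^ (N - 2))
  have hint : (∫ w, φ w ^ N).re - √(Real.pi / (N * a)) =
      ∫ w, ((φ w ^ N).re - Real.exp (-(N * a) * w ^ 2)) := by
    have hre : ∫ w, (φ w ^ N).re = (∫ w, φ w ^ N).re := integral_re hi1
    have hi1' : Integrable fun w => (φ w ^ N).re := hi1.re
    rw [integral_sub hi1' hi2, integral_gaussian, hre]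
  rw [hint]
  have hnorm := norm_integral_le_of_norm_le
    (f := fun w => (φ w ^ N).re - Real.exp (-(N * a) * w ^ 2)) (hi3.add hi4) (.of_forall (hpt N hN))
  simp only [Pi.add_apply, Real.norm_eq_abs] at hnorm
  calc |∫ w, ((φ w ^ N).re - Real.exp (-(N * a) * w ^ 2))|
      ≤ ∫ w, ((N : ℝ)⁻¹ * gaussianError (a / 4) c (k ^ 2 / 2) (√N * w) +
          q ^ (N - 2) * (A * (1 + w ^ 2)⁻¹)) :=
        hnorm
    _ = (N : ℝ)⁻¹ * ((√N)⁻¹ * P) + q ^ (N - 2) * (A * Real.pi) := by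
        rw [integral_add hi3 hi4, integral_const_mul, integral_const_mul, integral_const_mul,
          integral_univ_inv_one_add_sq, Measure.integral_comp_mul_left, abs_of_pos (by positivity),
          smul_eq_mul]
    _ ≤ (N : ℝ)⁻¹ * ((√N)⁻¹ * P) + (N : ℝ)⁻¹ * (√N)⁻¹ * B * (A * Real.pi) := by
        -- The tail uses `q ^ (N - 2) ≤ B / N²` and `√N ≤ N`.
        gcongr
        rw [← mul_inv, inv_mul_eq_div, le_div_iff₀ (by positivity)]
        refine le_trans ?_ (hB N hN)
        rw [sq]
        gcongr
        exact Real.sqrt_le_self_iff.2 (Or.inr hN1)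
    _ = _ := by
        rw [hsplit]
        field_simp


/-! ### Taylor expansion of the tilted law and the saddle-point estimate -/

/-- Third-order Taylor expansion at `0` of the Fourier transform of the weight
`exp (t * (x - u))` on `[-1, 1]`, centred at its barycentre `u`. -/
lemma norm_integral_sub_taylor_le {t u Z a : ℝ} (hZ : 0 < Z)
    (h0 : 1 / 2 * ∫ x in (-1 : ℝ)..1, Real.exp (t * (x - u)) = Z)
    (h1 : ∫ x in (-1 : ℝ)..1, (x - u) * Real.exp (t * (x - u)) = 0)
    (h2 : 1 / 2 * ∫ x in (-1 : ℝ)..1, (x - u) ^ 2 * Real.exp (t * (x - u)) = 2 * a * Z)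
    {k : ℝ} (h3 : 1 / 2 * ∫ x in (-1 : ℝ)..1, (x - u) ^ 3 * Real.exp (t * (x - u)) = -6 * k * Z)
    {w : ℝ} (hw : |w| * (1 + |u|) ≤ 1) :
    ‖(1 / 2 * ∫ x in (-1 : ℝ)..1,
        (Real.exp (t * (x - u)) : ℂ) * Complex.exp ((w * (x - u) : ℝ) * Complex.I)) / Z -
      (1 + ((-a * w ^ 2 : ℝ) + (k * w ^ 3 : ℝ) * Complex.I))‖ ≤ (1 + |u|) ^ 4 * w ^ 4 := by
  set e : ℝ → ℝ := fun x => Real.exp (t * (x - u)) with he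
  -- The integral of this cubic Taylor polynomial against `e` is given exactly by the moments
  -- `h0`–`h3`; only the quartic remainder has to be estimated.
  set T : ℝ → ℂ := fun x => ∑ m ∈ Finset.range 4, ((w * (x - u) : ℝ) * Complex.I) ^ m / m.factorial
    with hT
  have hTc : Continuous T := by simp only [hT]; fun_prop
  have hec : Continuous e := by simp only [he]; fun_prop
  have hii : ∀ f : ℝ → ℝ, Continuous f → IntervalIntegrable f volume (-1) 1 :=
    fun f hf => hf.intervalIntegrable _ _
  have hpoly : 1 / 2 * ∫ x in (-1 : ℝ)..1, (e x : ℂ) * T x =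
      Z * (1 + ((-a * w ^ 2 : ℝ) + (k * w ^ 3 : ℝ) * Complex.I)) := by
    have hexp : ∀ x, (e x : ℂ) * T x = ((e x - w ^ 2 / 2 * ((x - u) ^ 2 * e x) : ℝ) : ℂ) +
        ((w * ((x - u) * e x) - w ^ 3 / 6 * ((x - u) ^ 3 * e x) : ℝ) : ℂ) * Complex.I := by
      intro x
      simp only [hT, Finset.sum_range_succ, Finset.sum_range_zero, mul_pow, Complex.I_sq,
        show Complex.I ^ 3 = -Complex.I by rw [pow_succ, Complex.I_sq]; ring]
      norm_num [Nat.factorial]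
      ring
    simp_rw [hexp]
    rw [intervalIntegral.integral_add ((by fun_prop : Continuous _).intervalIntegrable _ _)
      ((by fun_prop : Continuous _).intervalIntegrable _ _), intervalIntegral.integral_mul_const,
      intervalIntegral.integral_ofReal, intervalIntegral.integral_ofReal,
      intervalIntegral.integral_sub (hii _ (by fun_prop)) (hii _ (by fun_prop)),
      intervalIntegral.integral_sub (hii _ (by fun_prop)) (hii _ (by fun_prop))]
    simp_rw [intervalIntegral.integral_const_mul]
    have h0' : ∫ x in (-1 : ℝ)..1, e x = 2 * Z := by linarith
    have h2' : ∫ x in (-1 : ℝ)..1, (x - u) ^ 2 * e x = 4 * a * Z := by linarith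
    have h3' : ∫ x in (-1 : ℝ)..1, (x - u) ^ 3 * e x = -12 * k * Z := by linarith
    rw [h0', h1, h2', h3']
    push_cast
    ring
  have hZc : (Z : ℂ) ≠ 0 := by exact_mod_cast hZ.ne'
  have hsub : (1 / 2 * ∫ x in (-1 : ℝ)..1,
        (e x : ℂ) * Complex.exp ((w * (x - u) : ℝ) * Complex.I)) / Z -
      (1 + ((-a * w ^ 2 : ℝ) + (k * w ^ 3 : ℝ) * Complex.I)) =
      (1 / 2 * ∫ x in (-1 : ℝ)..1,
        (e x : ℂ) * (Complex.exp ((w * (x - u) : ℝ) * Complex.I) - T x)) / Z := by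
    simp_rw [mul_sub]
    rw [intervalIntegral.integral_sub ((by fun_prop : Continuous _).intervalIntegrable _ _)
      ((by fun_prop : Continuous _).intervalIntegrable _ _), mul_sub, hpoly, sub_div,
      mul_div_cancel_left₀ _ hZc]
  rw [hsub, norm_div, Complex.norm_real, Real.norm_of_nonneg hZ.le, div_le_iff₀ hZ, norm_mul]
  have hb : ‖∫ x in (-1 : ℝ)..1,
        (e x : ℂ) * (Complex.exp ((w * (x - u) : ℝ) * Complex.I) - T x)‖ ≤
      ∫ x in (-1 : ℝ)..1, e x * ((1 + |u|) ^ 4 * w ^ 4) := by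
    refine intervalIntegral.norm_integral_le_of_norm_le (by norm_num)
      (.of_forall fun x hx => ?_) (hii _ (by fun_prop))
    have hxu : |x - u| ≤ 1 + |u| :=
      (abs_sub _ _).trans (add_le_add_left (abs_le.2 ⟨hx.1.le, hx.2⟩) _)
    have hn : ‖((w * (x - u) : ℝ) : ℂ) * Complex.I‖ = |w| * |x - u| := by
      rw [norm_mul, Complex.norm_I, mul_one, Complex.norm_real, Real.norm_eq_abs, abs_mul]
    have hn' : |w| * |x - u| ≤ |w| * (1 + |u|) := by gcongr
    have hexp := Complex.exp_bound (hn.trans_le (hn'.trans hw)) (n := 4) (by norm_num)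
    rw [norm_mul, Complex.norm_real, Real.norm_of_nonneg (Real.exp_pos _).le]
    refine mul_le_mul_of_nonneg_left (hexp.trans ?_) (Real.exp_pos _).le
    rw [hn]
    -- The constant of the exponential remainder is `5 / 96`, bounded here by `1`.
    calc (|w| * |x - u|) ^ 4 * (((4 : ℕ).succ : ℝ) * (((4 : ℕ).factorial : ℝ) * (4 : ℕ))⁻¹)
        ≤ (|w| * (1 + |u|)) ^ 4 * 1 := by
          gcongr
          norm_num [Nat.factorial]
      _ = (1 + |u|) ^ 4 * w ^ 4 := by
          rw [mul_one, mul_pow, Even.pow_abs (by decide : Even 4) w, mul_comm]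
  rw [intervalIntegral.integral_mul_const] at hb
  have h0' : ∫ x in (-1 : ℝ)..1, e x = 2 * Z := by linarith
  rw [h0'] at hb
  have : ‖(1 / 2 : ℂ)‖ = 1 / 2 := by norm_num
  rw [this]
  linarith

lemma uniformMGF_mul_exp_eq_integral (t u w : ℝ) :
    uniformMGF (t + w * Complex.I) * Complex.exp (-((t + w * Complex.I) * u)) =
      1 / 2 * ∫ x in (-1 : ℝ)..1,
        (Real.exp (t * (x - u)) : ℂ) * Complex.exp ((w * (x - u) : ℝ) * Complex.I) := by
  rw [uniformMGF, integral_uniformDensity_mul, mul_assoc, ← intervalIntegral.integral_mul_const]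
  congr 2
  ext x
  rw [Complex.ofReal_exp, ← Complex.exp_add, ← Complex.exp_add]
  congr 1
  push_cast
  ring

/-- Saddle-point approximation of the density of the mean: `t` is the tilt for which the
exponentially tilted uniform law has mean `u`, `Z` its normalization, `2 * a` its variance. -/
lemma exists_abs_meanDensity_sub_le {t u Z a : ℝ} (hZ : 0 < Z) (ha : 0 < a)
    (h0 : 1 / 2 * ∫ x in (-1 : ℝ)..1, Real.exp (t * (x - u)) = Z)
    (h1 : ∫ x in (-1 : ℝ)..1, (x - u) * Real.exp (t * (x - u)) = 0)
    (h2 : 1 / 2 * ∫ x in (-1 : ℝ)..1, (x - u) ^ 2 * Real.exp (t * (x - u)) = 2 * a * Z) :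
    ∃ K, ∀ N : ℕ, 2 ≤ N →
      |meanDensity N u - N / (2 * Real.pi) * Z ^ N * √(Real.pi / (N * a))| ≤
        K * (1 / N) * (N / (2 * Real.pi) * Z ^ N * √(Real.pi / (N * a))) := by
  set ψ : ℝ → ℂ := fun w =>
    uniformMGF (t + w * Complex.I) * Complex.exp (-((t + w * Complex.I) * u)) with hψ
  set φ : ℝ → ℂ := fun w => ψ w / Z with hφ
  have hZc : (Z : ℂ) ≠ 0 := by exact_mod_cast hZ.ne'
  have hψ0 : ψ 0 = Z := by
    simp only [hψ]
    rw [uniformMGF_mul_exp_eq_integral, ← h0]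
    simp [← intervalIntegral.integral_ofReal]
  have hψn : ∀ w, ‖ψ w‖ = ‖uniformMGF (t + w * Complex.I)‖ * Real.exp (-(t * u)) := by
    intro w
    simp [hψ, Complex.norm_exp]
  have hZn : Z = ‖uniformMGF t‖ * Real.exp (-(t * u)) := by
    have := hψn 0
    rw [hψ0] at this
    simpa [abs_of_pos hZ] using this
  have hφn : ∀ w, ‖φ w‖ = ‖ψ w‖ / Z := by
    intro w
    simp only [hφ]
    rw [norm_div, Complex.norm_real, Real.norm_of_nonneg hZ.le]
  have hcont : Continuous φ := by
    have := continuous_uniformMGF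
    simp only [hφ, hψ]
    fun_prop
  have hlt : ∀ w, w ≠ 0 → ‖φ w‖ < 1 := by
    intro w hw
    rw [hφn, div_lt_one hZ, hψn, hZn]
    exact mul_lt_mul_of_pos_right (norm_uniformMGF_lt t hw) (Real.exp_pos _)
  have hA : ∀ w, ‖φ w‖ ^ 2 ≤ ((‖uniformMGF t‖ ^ 2 + Real.sinh t ^ 2 + 1) *
      (Real.exp (-(t * u)) / Z) ^ 2) * (1 + w ^ 2)⁻¹ := by
    intro w
    rw [hφn, hψn, mul_div_assoc, mul_pow, mul_right_comm]
    exact mul_le_mul_of_nonneg_right (norm_uniformMGF_sq_le t w) (sq_nonneg _)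
  have hu : 0 < 1 + |u| := by positivity
  -- `k` is read off from the third central moment; its value affects only `K`, not the leading
  -- term.
  obtain ⟨K, hK⟩ := exists_abs_integral_pow_sub_le hcont hlt hA ha
    (k := -(1 / 2 * ∫ x in (-1 : ℝ)..1, (x - u) ^ 3 * Real.exp (t * (x - u))) / (6 * Z))
    (C := (1 + |u|) ^ 4) (δ₀ := 1 / (1 + |u|)) (by positivity) (by positivity) fun w hw => by
      simp only [hφ, hψ]
      rw [uniformMGF_mul_exp_eq_integral]
      refine norm_integral_sub_taylor_le hZ h0 h1 h2 ?_ ((le_div_iff₀ hu).1 hw)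
      generalize ∫ x in (-1 : ℝ)..1, (x - u) ^ 3 * Real.exp (t * (x - u)) = J
      field_simp
  refine ⟨K, fun N hN => ?_⟩
  have hmean : meanDensity N u = N / (2 * Real.pi) * Z ^ N * (∫ w, φ w ^ N).re := by
    have h := meanDensity_eq_integral hN t u
    have hpow : ∀ w : ℝ, (uniformMGF (t + w * Complex.I) *
        Complex.exp (-((t + w * Complex.I) * u))) ^ N = (Z : ℂ) ^ N * φ w ^ N := by
      intro w
      simp only [hφ]
      rw [← mul_pow, mul_div_cancel₀ _ hZc]
    simp_rw [hpow] at h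
    rw [integral_const_mul, ← mul_assoc] at h
    have hc : (N : ℂ) / (2 * Real.pi) * (Z : ℂ) ^ N = ((N / (2 * Real.pi) * Z ^ N : ℝ) : ℂ) := by
      push_cast; ring
    rw [hc] at h
    have := congrArg Complex.re h
    rwa [Complex.ofReal_re, Complex.re_ofReal_mul] at this
  have hpos : 0 ≤ N / (2 * Real.pi) * Z ^ N := by positivity
  rw [hmean, ← mul_sub, abs_mul, abs_of_nonneg hpos]
  calc _ ≤ N / (2 * Real.pi) * Z ^ N * (K * (1 / N) * √(Real.pi / (N * a))) :=
        mul_le_mul_of_nonneg_left (hK N hN) hpos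
    _ = _ := by ring

/-! ### Relative errors and the explicit saddle point -/

/-- With `r = f / g - 1` the identity also holds at `N = 1`, where no error bound is available;
big-O ignores that term. -/
lemma exists_isBigO_of_abs_sub_le {f g : ℕ → ℝ} {K : ℝ} (hg : ∀ N, 1 ≤ N → 0 < g N)
    (h : ∀ N : ℕ, 2 ≤ N → |f N - g N| ≤ K * (1 / N) * g N) :
    ∃ r : ℕ → ℝ, r =O[atTop] (fun N : ℕ => 1 / (N : ℝ)) ∧
      ∀ N : ℕ, 1 ≤ N → f N = g N * (1 + r N) := by
  refine ⟨fun N => f N / g N - 1, IsBigO.of_bound K ?_, fun N hN => ?_⟩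
  · filter_upwards [eventually_ge_atTop 2] with N hN
    have hg' := hg N (by lia)
    rw [Real.norm_eq_abs, Real.norm_of_nonneg (by positivity), div_sub_one hg'.ne', abs_div,
      abs_of_pos hg', div_le_iff₀ hg']
    exact h N hN
  · have := (hg N hN).ne'
    field_simp
    ring

lemma sq_lt_sinh_sq {y : ℝ} (hy : y ≠ 0) : y ^ 2 < Real.sinh y ^ 2 := by
  rw [sq_lt_sq, Real.abs_sinh]
  exact Real.self_lt_sinh_iff.2 (abs_pos.2 hy)

lemma integral_exp_mul_sub {t : ℝ} (ht : t ≠ 0) (u : ℝ) :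
    ∫ x in (-1 : ℝ)..1, Real.exp (t * (x - u)) =
      Real.exp (t * (1 - u)) / t - Real.exp (t * (-1 - u)) / t := by
  refine intervalIntegral.integral_eq_sub_of_hasDerivAt
    (f := fun x => Real.exp (t * (x - u)) / t) (fun x _ => ?_)
    ((by fun_prop : Continuous _).intervalIntegrable _ _)
  have h : HasDerivAt (fun x => t * (x - u)) (t * 1) x := ((hasDerivAt_id x).sub_const u).const_mul t
  convert! h.exp.div_const t using 1
  field_simp

lemma integral_sub_mul_exp_mul_sub {t : ℝ} (ht : t ≠ 0) (u : ℝ) :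
    ∫ x in (-1 : ℝ)..1, (x - u) * Real.exp (t * (x - u)) =
      ((1 - u) / t - 1 / t ^ 2) * Real.exp (t * (1 - u)) -
        ((-1 - u) / t - 1 / t ^ 2) * Real.exp (t * (-1 - u)) := by
  refine intervalIntegral.integral_eq_sub_of_hasDerivAt
    (f := fun x => ((x - u) / t - 1 / t ^ 2) * Real.exp (t * (x - u))) (fun x _ => ?_)
    ((by fun_prop : Continuous _).intervalIntegrable _ _)
  have h0 : HasDerivAt (fun x => x - u) 1 x := (hasDerivAt_id x).sub_const u
  convert! ((h0.div_const t).sub_const (1 / t ^ 2)).mul (h0.const_mul t).exp using 1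
  field_simp
  ring

lemma integral_sub_sq_mul_exp_mul_sub {t : ℝ} (ht : t ≠ 0) (u : ℝ) :
    ∫ x in (-1 : ℝ)..1, (x - u) ^ 2 * Real.exp (t * (x - u)) =
      ((1 - u) ^ 2 / t - (1 - u) * (2 / t ^ 2) + 2 / t ^ 3) * Real.exp (t * (1 - u)) -
        ((-1 - u) ^ 2 / t - (-1 - u) * (2 / t ^ 2) + 2 / t ^ 3) * Real.exp (t * (-1 - u)) := by
  refine intervalIntegral.integral_eq_sub_of_hasDerivAt
    (f := fun x => ((x - u) ^ 2 / t - (x - u) * (2 / t ^ 2) + 2 / t ^ 3) * Real.exp (t * (x - u)))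
    (fun x _ => ?_) ((by fun_prop : Continuous _).intervalIntegrable _ _)
  have h0 : HasDerivAt (fun x => x - u) 1 x := (hasDerivAt_id x).sub_const u
  convert! ((((h0.pow 2).div_const t).sub (h0.mul_const (2 / t ^ 2))).add_const (2 / t ^ 3)).mul
    (h0.const_mul t).exp using 1
  simp only [Pi.pow_apply, Pi.sub_apply]
  field_simp
  ring

/-- The mean of the law tilted by `t` is `(log M)'(t) = coth t - 1 / t`, which equals `u` at `t =
-y`. The variance there is `1 / y² - 1 / sinh² y`, and `a` is half of it. -/
lemma meanDensity_asymptotic_of_ne_zero {y u : ℝ} (hy : y ≠ 0)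
    (hu : u = 1 / y - Real.cosh y / Real.sinh y) :
    ∃ r : ℕ → ℝ, r =O[atTop] (fun N : ℕ => 1 / (N : ℝ)) ∧
      ∀ N : ℕ, 1 ≤ N →
        meanDensity N u =
          y * Real.sinh y *
            Real.sqrt (N / (2 * Real.pi * (Real.sinh y ^ 2 - y ^ 2))) *
            (Real.sinh y / y * Real.exp (u * y)) ^ N * (1 + r N) := by
  have hs0 : Real.sinh y ≠ 0 := by simpa using hy
  have hlt := sq_lt_sinh_sq hy
  have hys : 0 < y * Real.sinh y := by
    rcases hy.lt_or_gt with h | h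
    · exact mul_pos_of_neg_of_neg h (Real.sinh_neg_iff.2 h)
    · exact mul_pos h (Real.sinh_pos_iff.2 h)
  have hsy : 0 < Real.sinh y / y := by
    rw [← mul_div_mul_left _ _ hy]
    have := mul_self_pos.2 hy
    positivity
  have hZ : 0 < Real.sinh y / y * Real.exp (u * y) := mul_pos hsy (Real.exp_pos _)
  have hd : 0 < Real.sinh y ^ 2 - y ^ 2 := by linarith
  have ha : 0 < (Real.sinh y ^ 2 - y ^ 2) / (2 * (y * Real.sinh y) ^ 2) := by positivity
  have he1 : Real.exp (-y * (1 - u)) = (Real.cosh y - Real.sinh y) * Real.exp (u * y) := by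
    rw [Real.cosh_sub_sinh, ← Real.exp_add]; ring_nf
  have he2 : Real.exp (-y * (-1 - u)) = (Real.cosh y + Real.sinh y) * Real.exp (u * y) := by
    rw [Real.cosh_add_sinh, ← Real.exp_add]; ring_nf
  have hcs := Real.cosh_sq y
  have hny : -y ≠ 0 := neg_ne_zero.2 hy
  obtain ⟨K, hK⟩ := exists_abs_meanDensity_sub_le (t := -y) (u := u) hZ ha
    (by
      rw [integral_exp_mul_sub hny, he1, he2]
      field_simp
      ring)
    (by
      rw [integral_sub_mul_exp_mul_sub hny, he1, he2]
      -- The exponential is abstracted first, so that substituting `u` leaves a rational identity in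
      -- `y`, `sinh y` and `cosh y`.
      generalize Real.exp (u * y) = E
      rw [hu]
      field_simp
      ring)
    (by
      rw [integral_sub_sq_mul_exp_mul_sub hny, he1, he2]
      generalize Real.exp (u * y) = E
      rw [hu]
      field_simp
      ring_nf
      simp only [hcs]
      ring)
  refine exists_isBigO_of_abs_sub_le (fun N hN => ?_) (K := K) fun N hN => ?_
  · have : (0 : ℝ) < N := by exact_mod_cast hN
    have := Real.sqrt_pos.2 (show 0 < N / (2 * Real.pi * (Real.sinh y ^ 2 - y ^ 2)) by positivity)
    positivity
  · have hN0 : (0 : ℝ) < N := by positivity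
    have hsq : N / (2 * Real.pi) *
        √(Real.pi / (N * ((Real.sinh y ^ 2 - y ^ 2) / (2 * (y * Real.sinh y) ^ 2)))) =
        y * Real.sinh y * √(N / (2 * Real.pi * (Real.sinh y ^ 2 - y ^ 2))) := by
      rw [← pow_left_inj₀ (by positivity) (by positivity) two_ne_zero, mul_pow, mul_pow _ (√_),
        Real.sq_sqrt (by positivity), Real.sq_sqrt (by positivity)]
      field_simp
    have := hK N hN
    rwa [mul_right_comm, hsq] at this

/-- No tilt is needed: the uniform law is centred with variance `1 / 3`, so `a = 1 / 6`. -/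
lemma meanDensity_zero_asymptotic :
    ∃ r : ℕ → ℝ, r =O[atTop] (fun N : ℕ => 1 / (N : ℝ)) ∧
      ∀ N : ℕ, 1 ≤ N →
        meanDensity N 0 = Real.sqrt (3 * N / (2 * Real.pi)) * (1 + r N) := by
  obtain ⟨K, hK⟩ := exists_abs_meanDensity_sub_le (t := 0) (u := 0) (Z := 1) (a := 1 / 6)
    one_pos (by norm_num) (by norm_num) (by norm_num) (by norm_num)
  refine exists_isBigO_of_abs_sub_le (fun N hN => ?_) (K := K) fun N hN => ?_
  · have : (0 : ℝ) < N := by exact_mod_cast hN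
    positivity
  · have hN0 : (0 : ℝ) < N := by positivity
    have hsq : N / (2 * Real.pi) * 1 ^ N * √(Real.pi / (N * (1 / 6))) =
        √(3 * N / (2 * Real.pi)) := by
      rw [← pow_left_inj₀ (by positivity) (by positivity) two_ne_zero, mul_pow,
        Real.sq_sqrt (by positivity), Real.sq_sqrt (by positivity)]
      field_simp
      norm_num
    have := hK N hN
    rwa [hsq] at this

theorem theorem4p1 :
    -- `meanDensity N` is the continuous density of the mean of `N` i.i.d. uniform variables
    (∀ N : ℕ, 2 ≤ N →
      Continuous (meanDensity N) ∧
      uniformMeanLaw N = volume.withDensity (fun u => ENNReal.ofReal (meanDensity N u))) ∧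
    -- its representation as an inverse Fourier transform
    (∀ N : ℕ, 2 ≤ N → ∀ u : ℝ,
      Integrable (fun ω : ℝ =>
        (Real.sinc (ω / N) : ℂ) ^ N * Complex.exp (-(Complex.I * ω * u))) ∧
      (meanDensity N u : ℂ) = 1 / (2 * Real.pi) *
        ∫ ω : ℝ, (Real.sinc (ω / N) : ℂ) ^ N * Complex.exp (-(Complex.I * ω * u))) ∧
    -- the asymptotic formula, for each fixed `y ≠ 0`
    (∀ y u : ℝ, y ≠ 0 → u = 1 / y - Real.cosh y / Real.sinh y →
      ∃ r : ℕ → ℝ, r =O[atTop] (fun N : ℕ => 1 / (N : ℝ)) ∧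
        ∀ N : ℕ, 1 ≤ N →
          meanDensity N u =
            y * Real.sinh y *
              Real.sqrt (N / (2 * Real.pi * (Real.sinh y ^ 2 - y ^ 2))) *
              (Real.sinh y / y * Real.exp (u * y)) ^ N * (1 + r N)) ∧
    -- the case `y = 0`, `u = 0`
    (∃ r : ℕ → ℝ, r =O[atTop] (fun N : ℕ => 1 / (N : ℝ)) ∧
      ∀ N : ℕ, 1 ≤ N →
        meanDensity N 0 = Real.sqrt (3 * N / (2 * Real.pi)) * (1 + r N)) := by
  exact ⟨fun N hN => ⟨continuous_meanDensity hN, uniformMeanLaw_eq_withDensity hN⟩,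
    fun N hN u => ⟨integrable_sinc_pow_mul_exp hN u, meanDensity_eq_integral_sinc hN u⟩,
    fun y u hy hu => meanDensity_asymptotic_of_ne_zero hy hu, meanDensity_zero_asymptotic⟩
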